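/- Theorem (Isbell's Density Theorem for biframes). A biframe $L=(L_0,L_1,L_2)$ is a frame $L_0$ (the ambient frame) with two subframes $L_1,L_2$ whose union generates $L_0$ as a frame. A biframe homomorphism $L\to M$ is a frame homomorphism $L_0\to M_0$ that maps $L_i$ into $M_i$ for $i=1,2$; it is dense if, for all $a\in L_0$, $f(a)=0$ implies $a=0$. For a frame or a biframe $X$, let $\mathcal S(X)$ be the poset of equivalence classes $\langle f\rangle$ of extremal epimorphisms $f$ with domain $X$ in the category of frames, respectively of biframes, where $\langle f\rangle\le\langle g\rangle$ iff $f=h\cdot g$ for some morphism $h$; its elements are called sublocales, respectively subbilocales, of $X$. A subbilocale is dense if the biframe homomorphisms that represent it are dense. For a biframe $L$ let $q_L\colon L_1\oplus L_2\to L_0$ be the frame homomorphism out of the coproduct induced by the two inclusions. For a frame homomorphism $f\colon L_0\to S$ let $f_i\colon L_i\to f[L_i]$ be its restrictions, and let $\overline f\colon L_0\to f(L)$ be the pushout, in the category of frames, of $f_1\oplus f_2\colon L_1\oplus L_2\to f[L_1]\oplus f[L_2]$ along $q_L$. Identifying $f[L_i]$ with its image in $f(L)$, this is a biframe homomorphism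 $\overline f\colon L\to(f(L),f[L_1],f[L_2])$. Let $\beta_{L_0}\colon L_0\to\mathfrak B(L_0)$, $a\mapsto a^{**}$, be the Booleanization of $L_0$, where $\mathfrak B(L_0)=\{a\in L_0: a=a^{**}\}$. Then, for every biframe $L$: (1) whenever $f\colon L_0\to S$ is an extremal epimorphism of frames, $\overline f$ is an extremal epimorphism of biframes, its ambient frame homomorphism is an extremal epimorphism of frames, and $\langle f\rangle\mapsto\langle\overline f\rangle$ is a well-defined closure operator $B_L$ on $\mathcal S(L_0)$; (2) $\beta_{L_0}$ is an extremal epimorphism of frames, $\overline{\beta_{L_0}}$ is an extremal epimorphism of biframes, the sublocale of $L_0$ given by the ambient map of $\overline{\beta_{L_0}}$ is $B_L\langle\beta_{L_0}\rangle$, and the subbilocale $\langle\overline{\beta_{L_0}}\rangle$ is the least dense subbilocale of $L$: it is dense, and $\langle\overline{\beta_{L_0}}\rangle\le\langle g\rangle$ for every dense subbilocale $\langle g\rangle$ of $L$. -/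

import Mathlib

open CategoryTheory

universe u v w

/-! ### Subframes -/

/-- A subframe: a subset closed under finite meets (including the top) and arbitrary joins. -/
structure Subframe (α : Type u) [Order.Frame α] where
  carrier : Set α
  top_mem : ⊤ ∈ carrier
  inf_mem : ∀ {a b : α}, a ∈ carrier → b ∈ carrier → a ⊓ b ∈ carrier
  sSup_mem : ∀ {s : Set α}, s ⊆ carrier → sSup s ∈ carrier

namespace Subframe

instance instSetLike {α : Type u} [Order.Frame α] : SetLike (Subframe α) α where
  coe S := S.carrier
  coe_injective := by
    rintro ⟨⟩ ⟨⟩ h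
    congr

/-- Order, finite meets and joins in a subframe are those of the ambient frame. -/
noncomputable instance instCompleteLattice {α : Type u} [Order.Frame α] (S : Subframe α) :
    CompleteLattice S :=
  { @completeLatticeOfSup S (Subtype.partialOrder _)
      ⟨fun s => ⟨sSup (Subtype.val '' s), S.sSup_mem (by rintro _ ⟨x, -, rfl⟩; exact x.2)⟩⟩
      (fun _ => ⟨fun x hx => Subtype.coe_le_coe.1 (le_sSup ⟨x, hx, rfl⟩),
        fun b hb => Subtype.coe_le_coe.1 (sSup_le (by
          rintro _ ⟨x, hx, rfl⟩
          exact Subtype.coe_le_coe.2 (hb hx)))⟩) with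
    inf := fun a b => ⟨a.1 ⊓ b.1, S.inf_mem a.2 b.2⟩
    inf_le_left := fun a b => Subtype.coe_le_coe.1 (inf_le_left (a := a.1) (b := b.1))
    inf_le_right := fun a b => Subtype.coe_le_coe.1 (inf_le_right (a := a.1) (b := b.1))
    le_inf := fun a b c hab hac => Subtype.coe_le_coe.1
      (le_inf (Subtype.coe_le_coe.2 hab) (Subtype.coe_le_coe.2 hac))
    top := ⟨⊤, S.top_mem⟩
    le_top := fun a => Subtype.coe_le_coe.1 (le_top (a := a.1)) }

theorem coe_sSup {α : Type u} [Order.Frame α] (S : Subframe α) (s : Set S) :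
    ((sSup s : S) : α) = sSup (Subtype.val '' s) := rfl

noncomputable instance instFrame {α : Type u} [Order.Frame α] (S : Subframe α) : Order.Frame S :=
  Order.Frame.ofMinimalAxioms
    { inf_sSup_le_iSup_inf := fun a s => by
        have h : (a.1 ⊓ sSup (Subtype.val '' s) : α) ≤ ((⨆ b ∈ s, a ⊓ b : S) : α) := by
          rw [inf_sSup_eq]
          refine iSup₂_le ?_
          rintro _ ⟨b, hb, rfl⟩
          exact Subtype.coe_le_coe.2 (le_iSup₂_of_le (f := fun b (_ : b ∈ s) => a ⊓ b) b hb le_rfl)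
        exact h }

/-- The inclusion of a subframe, as a frame homomorphism. -/
def incl {α : Type u} [Order.Frame α] (S : Subframe α) : FrameHom S α where
  toFun := Subtype.val
  map_inf' _ _ := rfl
  map_top' := rfl
  map_sSup' _ := rfl

/-- The image of a subframe under a frame homomorphism. -/
def map {α : Type u} {β : Type v} [Order.Frame α] [Order.Frame β] (f : FrameHom α β)
    (S : Subframe α) : Subframe β where
  carrier := f '' (S : Set α)
  top_mem := ⟨⊤, S.top_mem, map_top f⟩
  inf_mem := by
    rintro _ _ ⟨a, ha, rfl⟩ ⟨b, hb, rfl⟩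
    exact ⟨a ⊓ b, S.inf_mem ha hb, map_inf f a b⟩
  sSup_mem := by
    intro s hs
    refine ⟨sSup ((S : Set α) ∩ f ⁻¹' s), S.sSup_mem Set.inter_subset_left, ?_⟩
    rw [map_sSup, Set.image_inter_preimage, Set.inter_eq_right.2 hs]

/-- The image of a frame homomorphism. -/
def range {α : Type u} {β : Type v} [Order.Frame α] [Order.Frame β] (f : FrameHom α β) :
    Subframe β where
  carrier := Set.range f
  top_mem := ⟨⊤, map_top f⟩
  inf_mem := by
    rintro _ _ ⟨a, rfl⟩ ⟨b, rfl⟩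
    exact ⟨a ⊓ b, map_inf f a b⟩
  sSup_mem := by
    intro s hs
    refine ⟨sSup (f ⁻¹' s), ?_⟩
    rw [map_sSup, Set.image_preimage_eq_inter_range, Set.inter_eq_left.2 hs]

/-- The preimage of a subframe under a frame homomorphism. -/
def comap {α : Type u} {β : Type v} [Order.Frame α] [Order.Frame β] (f : FrameHom α β)
    (S : Subframe β) : Subframe α where
  carrier := f ⁻¹' (S : Set β)
  top_mem := by
    change f ⊤ ∈ S.carrier
    rw [map_top]
    exact S.top_mem
  inf_mem := by
    intro a b ha hb
    change f (a ⊓ b) ∈ S.carrier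
    rw [map_inf]
    exact S.inf_mem ha hb
  sSup_mem := by
    intro s hs
    change f (sSup s) ∈ S.carrier
    rw [map_sSup]
    exact S.sSup_mem (by rintro _ ⟨a, ha, rfl⟩; exact hs ha)

/-- The restriction `S → f[S]` of a frame homomorphism `f`. -/
def mapHom {α : Type u} {β : Type v} [Order.Frame α] [Order.Frame β] (f : FrameHom α β)
    (S : Subframe α) : FrameHom S (S.map f) where
  toFun a := ⟨f a, ⟨a, a.2, rfl⟩⟩
  map_inf' a b := Subtype.ext (map_inf f a.1 b.1)
  map_top' := Subtype.ext (map_top f)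
  map_sSup' s := Subtype.ext (by
    change f (sSup (Subtype.val '' s)) = sSup (Subtype.val '' _)
    rw [map_sSup, Set.image_image, Set.image_image])

end Subframe

/-! ### Frame congruences and quotient frames -/

/-- A frame congruence: an equivalence relation respecting binary meets and arbitrary joins. -/
structure FrameCongruence (α : Type u) [Order.Frame α] extends Setoid α where
  inf_congr : ∀ {a b c d : α}, r a b → r c d → r (a ⊓ c) (b ⊓ d)
  iSup_congr : ∀ {ι : Type u} {a b : ι → α}, (∀ i, r (a i) (b i)) → r (⨆ i, a i) (⨆ i, b i)

namespace FrameCongruence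

/-- The least frame congruence containing a relation. -/
def gen {α : Type u} [Order.Frame α] (R : α → α → Prop) : FrameCongruence α where
  r a b := ∀ C : FrameCongruence α, (∀ x y, R x y → C.r x y) → C.r a b
  iseqv :=
    { refl := fun a C _ => C.iseqv.refl a
      symm := fun h C hC => C.iseqv.symm (h C hC)
      trans := fun h h' C hC => C.iseqv.trans (h C hC) (h' C hC) }
  inf_congr h h' C hC := C.inf_congr (h C hC) (h' C hC)
  iSup_congr h C hC := C.iSup_congr fun i => h i C hC

/-- The quotient of a frame by a frame congruence. -/
def Quotient {α : Type u} [Order.Frame α] (C : FrameCongruence α) : Type u :=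
  _root_.Quotient C.toSetoid

/-- The class of an element. -/
def cls {α : Type u} [Order.Frame α] (C : FrameCongruence α) (a : α) : C.Quotient :=
  _root_.Quotient.mk C.toSetoid a

theorem cls_eq {α : Type u} [Order.Frame α] (C : FrameCongruence α) {a b : α} :
    C.cls a = C.cls b ↔ C.r a b :=
  Quotient.eq (r := C.toSetoid)

theorem cls_surjective {α : Type u} [Order.Frame α] (C : FrameCongruence α) :
    Function.Surjective C.cls :=
  fun x => Quotient.exists_rep x

/-- The meet of two classes. -/
def inf {α : Type u} [Order.Frame α] (C : FrameCongruence α) (x y : C.Quotient) : C.Quotient :=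
  Quotient.map₂ (· ⊓ ·) (fun _ _ h _ _ h' => C.inf_congr h h') x y

/-- `x ≤ y` means `x ⊓ y = x`. -/
instance instPartialOrder {α : Type u} [Order.Frame α] (C : FrameCongruence α) :
    PartialOrder C.Quotient where
  le x y := C.inf x y = x
  le_refl x := by
    obtain ⟨a, rfl⟩ := C.cls_surjective x
    exact congrArg C.cls (inf_idem a)
  le_trans x y z hxy hyz := by
    obtain ⟨a, rfl⟩ := C.cls_surjective x
    obtain ⟨b, rfl⟩ := C.cls_surjective y
    obtain ⟨c, rfl⟩ := C.cls_surjective z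
    have h1 : C.r (a ⊓ b) a := C.cls_eq.1 hxy
    have h2 : C.r (b ⊓ c) b := C.cls_eq.1 hyz
    have h3 : C.r (a ⊓ b ⊓ c) (a ⊓ c) := C.inf_congr h1 (C.iseqv.refl c)
    have h4 : C.r (a ⊓ b ⊓ c) (a ⊓ b) := by
      rw [inf_assoc]
      exact C.inf_congr (C.iseqv.refl a) h2
    exact C.cls_eq.2 (C.iseqv.trans (C.iseqv.symm h3) (C.iseqv.trans h4 h1))
  le_antisymm x y hxy hyx := by
    obtain ⟨a, rfl⟩ := C.cls_surjective x
    obtain ⟨b, rfl⟩ := C.cls_surjective y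
    have h1 : C.r (a ⊓ b) a := C.cls_eq.1 hxy
    have h2 : C.r (b ⊓ a) b := C.cls_eq.1 hyx
    rw [inf_comm] at h2
    exact C.cls_eq.2 (C.iseqv.trans (C.iseqv.symm h1) h2)

theorem cls_le {α : Type u} [Order.Frame α] (C : FrameCongruence α) {a b : α} :
    C.cls a ≤ C.cls b ↔ C.r (a ⊓ b) a := C.cls_eq

theorem cls_mono {α : Type u} [Order.Frame α] (C : FrameCongruence α) : Monotone C.cls :=
  fun a _ h => C.cls_le.2 ((inf_eq_left.2 h).symm ▸ C.iseqv.refl a)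

theorem isLUB_cls_iSup {α : Type u} [Order.Frame α] (C : FrameCongruence α) {ι : Type u}
    (a : ι → α) : IsLUB (Set.range fun i => C.cls (a i)) (C.cls (⨆ i, a i)) := by
  constructor
  · rintro _ ⟨i, rfl⟩
    exact C.cls_mono (le_iSup a i)
  · intro y hy
    obtain ⟨b, rfl⟩ := C.cls_surjective y
    refine C.cls_le.2 ?_
    rw [iSup_inf_eq]
    exact C.iSup_congr fun i => C.cls_le.1 (hy ⟨i, rfl⟩)

noncomputable instance instCompleteLattice {α : Type u} [Order.Frame α] (C : FrameCongruence α) :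
    CompleteLattice C.Quotient :=
  { @completeLatticeOfSup C.Quotient (instPartialOrder C)
      ⟨fun s => C.cls (⨆ x : s, Quotient.out x.1)⟩
      (fun s => by
        have h := C.isLUB_cls_iSup fun x : s => Quotient.out x.1
        have e : (Set.range fun x : s => C.cls (Quotient.out x.1)) = s := by
          ext y
          constructor
          · rintro ⟨x, rfl⟩
            have hx : C.cls (Quotient.out x.1) = x.1 := Quotient.out_eq x.1
            have hm : x.1 ∈ s := x.2
            rwa [← hx] at hm
          · intro hy
            exact ⟨⟨y, hy⟩, Quotient.out_eq y⟩
        rwa [e] at h) with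
    inf := C.inf
    inf_le_left := fun x y => by
      obtain ⟨a, rfl⟩ := C.cls_surjective x
      obtain ⟨b, rfl⟩ := C.cls_surjective y
      exact C.cls_mono inf_le_left
    inf_le_right := fun x y => by
      obtain ⟨a, rfl⟩ := C.cls_surjective x
      obtain ⟨b, rfl⟩ := C.cls_surjective y
      exact C.cls_mono inf_le_right
    le_inf := fun x y z hxy hxz => by
      obtain ⟨a, rfl⟩ := C.cls_surjective x
      obtain ⟨b, rfl⟩ := C.cls_surjective y
      obtain ⟨c, rfl⟩ := C.cls_surjective z
      have h1 : C.r (a ⊓ b) a := C.cls_le.1 hxy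
      have h2 : C.r (a ⊓ c) a := C.cls_le.1 hxz
      refine C.cls_le.2 ?_
      rw [← inf_assoc]
      exact C.iseqv.trans (C.inf_congr h1 (C.iseqv.refl c)) h2
    top := C.cls ⊤
    le_top := fun x => by
      obtain ⟨a, rfl⟩ := C.cls_surjective x
      exact C.cls_mono le_top }

theorem cls_iSup {α : Type u} [Order.Frame α] (C : FrameCongruence α) {ι : Type u}
    (a : ι → α) : C.cls (⨆ i, a i) = ⨆ i, C.cls (a i) :=
  (C.isLUB_cls_iSup a).unique isLUB_iSup

noncomputable instance instFrame {α : Type u} [Order.Frame α] (C : FrameCongruence α) :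
    Order.Frame C.Quotient :=
  Order.Frame.ofMinimalAxioms
    { inf_sSup_le_iSup_inf := fun x s => by
        obtain ⟨a, rfl⟩ := C.cls_surjective x
        choose g hg using C.cls_surjective
        have hs : sSup s = C.cls (⨆ y : s, g y.1) := by
          rw [C.cls_iSup, sSup_eq_iSup']
          exact _root_.iSup_congr fun y => (hg y.1).symm
        have hi : C.cls a ⊓ C.cls (⨆ y : s, g y.1) = C.cls (a ⊓ ⨆ y : s, g y.1) := rfl
        rw [hs, hi, inf_iSup_eq, C.cls_iSup]
        refine iSup_le fun y => ?_
        have hy : C.cls (a ⊓ g y.1) = C.cls a ⊓ y.1 := by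
          conv_rhs => rw [← hg y.1]
          rfl
        rw [hy]
        exact le_iSup₂_of_le (f := fun b (_ : b ∈ s) => C.cls a ⊓ b) y.1 y.2 le_rfl }

/-- The quotient map, as a frame homomorphism. -/
noncomputable def proj {α : Type u} [Order.Frame α] (C : FrameCongruence α) :
    FrameHom α C.Quotient where
  toFun := C.cls
  map_inf' _ _ := rfl
  map_top' := rfl
  map_sSup' s := by
    rw [sSup_eq_iSup', C.cls_iSup, sSup_image']

/-- A frame homomorphism identifying congruent elements factors through the quotient. -/
noncomputable def lift {α : Type u} {β : Type v} [Order.Frame α] [Order.Frame β]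
    (C : FrameCongruence α) (f : FrameHom α β) (hf : ∀ a b, C.r a b → f a = f b) :
    FrameHom C.Quotient β where
  toFun := Quotient.lift f hf
  map_inf' x y := by
    obtain ⟨a, rfl⟩ := C.cls_surjective x
    obtain ⟨b, rfl⟩ := C.cls_surjective y
    exact map_inf f a b
  map_top' := map_top f
  map_sSup' s := by
    choose g hg using C.cls_surjective
    have hs : sSup s = C.cls (⨆ y : s, g y.1) := by
      rw [C.cls_iSup, sSup_eq_iSup']
      exact _root_.iSup_congr fun y => (hg y.1).symm
    rw [hs]
    refine (map_iSup f fun y : s => g y.1).trans ?_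
    have h : ∀ x : C.Quotient, Quotient.lift f hf x = f (g x) := fun x => by
      conv_lhs => rw [← hg x]
      rfl
    refine (_root_.iSup_congr fun y : s => (h y.1).symm).trans ?_
    exact (sSup_image' (s := s) (f := fun x : C.Quotient => Quotient.lift f hf x)).symm

/-- The kernel congruence of a frame homomorphism. -/
def ker {α : Type u} {β : Type v} [Order.Frame α] [Order.Frame β] (f : FrameHom α β) :
    FrameCongruence α where
  r a b := f a = f b
  iseqv := ⟨fun _ => rfl, fun h => h.symm, fun h h' => h.trans h'⟩
  inf_congr h h' := by rw [map_inf, map_inf, h, h']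
  iSup_congr h := by rw [map_iSup, map_iSup]; exact _root_.iSup_congr h

end FrameCongruence

/-! ### Coproducts and pushouts of frames -/

/-- The relations that force `(a, b) ↦ a ⊕ b` to preserve arbitrary joins in each variable. -/
inductive FrameCoprodRel (α β : Type u) [Order.Frame α] [Order.Frame β] :
    LowerSet (α × β) → LowerSet (α × β) → Prop
  | left (s : Set α) (b : β) :
      FrameCoprodRel α β (⨆ a : s, LowerSet.Iic (a.1, b)) (LowerSet.Iic (sSup s, b))
  | right (a : α) (s : Set β) :
      FrameCoprodRel α β (⨆ b : s, LowerSet.Iic (a, b.1)) (LowerSet.Iic (a, sSup s))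

/-- The coproduct `α ⊕ β` of two frames: the quotient of the frame of lower sets of `α × β`. -/
abbrev FrameCoprod (α β : Type u) [Order.Frame α] [Order.Frame β] : Type u :=
  (FrameCongruence.gen (FrameCoprodRel α β)).Quotient

namespace FrameCoprod

/-- The element `a ⊕ b` of the coproduct. -/
noncomputable def tmul {α β : Type u} [Order.Frame α] [Order.Frame β] (a : α) (b : β) :
    FrameCoprod α β :=
  FrameCongruence.proj _ (LowerSet.Iic (a, b))

theorem tmul_inf {α β : Type u} [Order.Frame α] [Order.Frame β] (a a' : α) (b b' : β) :
    tmul (a ⊓ a') (b ⊓ b') = tmul a b ⊓ tmul a' b' := by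
  have h : LowerSet.Iic (a ⊓ a', b ⊓ b') = LowerSet.Iic (a, b) ⊓ LowerSet.Iic (a', b') := by
    ext ⟨x, y⟩
    simp [Prod.le_def]
  rw [tmul, h, map_inf]
  rfl

theorem tmul_top {α β : Type u} [Order.Frame α] [Order.Frame β] :
    tmul (⊤ : α) (⊤ : β) = ⊤ := by
  have h : LowerSet.Iic ((⊤ : α), (⊤ : β)) = ⊤ := by
    ext ⟨x, y⟩
    simp [Prod.le_def]
  rw [tmul, h, map_top]

theorem sSup_tmul {α β : Type u} [Order.Frame α] [Order.Frame β] (s : Set α) (b : β) :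
    tmul (sSup s) b = ⨆ a : s, tmul a.1 b := by
  have h : FrameCongruence.proj (FrameCongruence.gen (FrameCoprodRel α β))
      (⨆ a : s, LowerSet.Iic (a.1, b)) = tmul (sSup s) b :=
    (FrameCongruence.cls_eq _).2 fun _ hC => hC _ _ (.left s b)
  rw [← h, map_iSup]
  rfl

theorem tmul_sSup {α β : Type u} [Order.Frame α] [Order.Frame β] (a : α) (s : Set β) :
    tmul a (sSup s) = ⨆ b : s, tmul a b.1 := by
  have h : FrameCongruence.proj (FrameCongruence.gen (FrameCoprodRel α β))
      (⨆ b : s, LowerSet.Iic (a, b.1)) = tmul a (sSup s) :=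
    (FrameCongruence.cls_eq _).2 fun _ hC => hC _ _ (.right a s)
  rw [← h, map_iSup]
  rfl

/-- The first coproduct injection `a ↦ a ⊕ 1`. -/
noncomputable def inl {α β : Type u} [Order.Frame α] [Order.Frame β] :
    FrameHom α (FrameCoprod α β) where
  toFun a := tmul a ⊤
  map_inf' a a' := by rw [← tmul_inf, inf_idem]
  map_top' := tmul_top
  map_sSup' s := by rw [sSup_tmul, sSup_image']

/-- The second coproduct injection `b ↦ 1 ⊕ b`. -/
noncomputable def inr {α β : Type u} [Order.Frame α] [Order.Frame β] :
    FrameHom β (FrameCoprod α β) where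
  toFun b := tmul ⊤ b
  map_inf' b b' := by rw [← tmul_inf, inf_idem]
  map_top' := tmul_top
  map_sSup' s := by rw [tmul_sSup, sSup_image']

/-- The homomorphism `D ↦ ⋁ {f a ∧ g b | (a, b) ∈ D}` on lower sets. -/
def preDesc {α β : Type u} {γ : Type v} [Order.Frame α] [Order.Frame β] [Order.Frame γ]
    (f : FrameHom α γ) (g : FrameHom β γ) : FrameHom (LowerSet (α × β)) γ where
  toFun D := ⨆ p : D, f p.1.1 ⊓ g p.1.2
  map_inf' D E := by
    rw [iSup_inf_iSup]
    apply le_antisymm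
    · exact iSup_le fun p => le_iSup_of_le (⟨p.1, p.2.1⟩, ⟨p.1, p.2.2⟩) (le_inf le_rfl le_rfl)
    · refine iSup_le fun p => ?_
      refine le_iSup_of_le ⟨p.1.1 ⊓ p.2.1, D.lower inf_le_left p.1.2,
        E.lower inf_le_right p.2.2⟩ ?_
      rw [inf_inf_inf_comm, ← map_inf, ← map_inf]
      rfl
  map_top' := top_le_iff.1 (le_iSup_of_le ⟨(⊤, ⊤), trivial⟩ (by simp))
  map_sSup' S := by
    apply le_antisymm
    · refine iSup_le fun p => ?_
      obtain ⟨D, hD, hp⟩ := LowerSet.mem_sSup_iff.1 p.2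
      exact le_sSup_of_le ⟨D, hD, rfl⟩ (le_iSup_of_le ⟨p.1, hp⟩ le_rfl)
    · refine sSup_le ?_
      rintro _ ⟨D, hD, rfl⟩
      exact iSup_le fun p => le_iSup_of_le ⟨p.1, LowerSet.mem_sSup_iff.2 ⟨D, hD, p.2⟩⟩ le_rfl

theorem preDesc_Iic {α β : Type u} {γ : Type v} [Order.Frame α] [Order.Frame β] [Order.Frame γ]
    (f : FrameHom α γ) (g : FrameHom β γ) (a : α) (b : β) :
    preDesc f g (LowerSet.Iic (a, b)) = f a ⊓ g b := by
  apply le_antisymm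
  · refine iSup_le fun p => ?_
    have hp : p.1 ≤ (a, b) := p.2
    exact inf_le_inf (OrderHomClass.mono f hp.1) (OrderHomClass.mono g hp.2)
  · exact le_iSup_of_le (f := fun p : LowerSet.Iic (a, b) => f p.1.1 ⊓ g p.1.2)
      ⟨(a, b), LowerSet.mem_Iic_iff.2 le_rfl⟩ le_rfl

/-- The homomorphism out of a coproduct determined by its two components:
it maps `a ⊕ b` to `f a ∧ g b`. -/
noncomputable def desc {α β : Type u} {γ : Type v} [Order.Frame α] [Order.Frame β] [Order.Frame γ]
    (f : FrameHom α γ) (g : FrameHom β γ) : FrameHom (FrameCoprod α β) γ :=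
  FrameCongruence.lift _ (preDesc f g) fun _ _ h =>
    h (FrameCongruence.ker (preDesc f g)) (by
      rintro _ _ (⟨s, b⟩ | ⟨a, s⟩)
      · change preDesc f g _ = preDesc f g _
        rw [map_iSup, preDesc_Iic, map_sSup, sSup_image', iSup_inf_eq]
        exact iSup_congr fun a => preDesc_Iic f g a.1 b
      · change preDesc f g _ = preDesc f g _
        rw [map_iSup, preDesc_Iic, map_sSup, sSup_image', inf_iSup_eq]
        exact iSup_congr fun b => preDesc_Iic f g a b.1)

theorem desc_tmul {α β : Type u} {γ : Type v} [Order.Frame α] [Order.Frame β] [Order.Frame γ]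
    (f : FrameHom α γ) (g : FrameHom β γ) (a : α) (b : β) :
    desc f g (tmul a b) = f a ⊓ g b :=
  preDesc_Iic f g a b

theorem desc_inl {α β : Type u} {γ : Type v} [Order.Frame α] [Order.Frame β] [Order.Frame γ]
    (f : FrameHom α γ) (g : FrameHom β γ) (a : α) : desc f g (inl a) = f a :=
  (desc_tmul f g a ⊤).trans (by rw [map_top, inf_top_eq])

theorem desc_inr {α β : Type u} {γ : Type v} [Order.Frame α] [Order.Frame β] [Order.Frame γ]
    (f : FrameHom α γ) (g : FrameHom β γ) (b : β) : desc f g (inr b) = g b :=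
  (desc_tmul f g ⊤ b).trans (by rw [map_top, top_inf_eq])

/-- A coproduct is generated by the images of the two injections. -/
theorem generated {α β : Type u} [Order.Frame α] [Order.Frame β]
    (S : Subframe (FrameCoprod α β)) (hl : ∀ a, inl a ∈ S) (hr : ∀ b, inr b ∈ S)
    (x : FrameCoprod α β) : x ∈ S := by
  obtain ⟨D, rfl⟩ := FrameCongruence.cls_surjective _ x
  have hD : D = sSup ((fun p : α × β => LowerSet.Iic p) '' D) := by
    ext p
    simp only [LowerSet.mem_sSup_iff, Set.mem_image, SetLike.mem_coe]
    exact ⟨fun hp => ⟨_, ⟨p, hp, rfl⟩, le_refl p⟩,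
      fun ⟨_, ⟨q, hq, rfl⟩, hpq⟩ => D.lower hpq hq⟩
  change FrameCongruence.proj _ D ∈ S
  rw [hD, map_sSup, Set.image_image]
  refine S.sSup_mem ?_
  rintro _ ⟨⟨a, b⟩, -, rfl⟩
  have h : tmul a b = inl a ⊓ inr b :=
    (congrArg₂ tmul (inf_top_eq a).symm (top_inf_eq b).symm).trans (tmul_inf a ⊤ ⊤ b)
  change tmul a b ∈ S
  rw [h]
  exact S.inf_mem (hl a) (hr b)

/-- The homomorphism `f ⊕ g` between coproducts. -/
noncomputable def map {α β α' β' : Type u} [Order.Frame α] [Order.Frame β] [Order.Frame α']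
    [Order.Frame β'] (f : FrameHom α α') (g : FrameHom β β') :
    FrameHom (FrameCoprod α β) (FrameCoprod α' β') :=
  desc (inl.comp f) (inr.comp g)

end FrameCoprod

/-- The pushout of two frame homomorphisms with common domain: the quotient of the coproduct of
the codomains by the congruence generated by `f x ⊕ 1 ∼ 1 ⊕ g x`. -/
abbrev FramePushout {α β γ : Type u} [Order.Frame α] [Order.Frame β] [Order.Frame γ]
    (f : FrameHom α β) (g : FrameHom α γ) : Type u :=
  (FrameCongruence.gen fun x y : FrameCoprod β γ =>
    ∃ a, x = FrameCoprod.inl (f a) ∧ y = FrameCoprod.inr (g a)).Quotient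

namespace FramePushout

/-- The first pushout injection. -/
noncomputable def inl {α β γ : Type u} [Order.Frame α] [Order.Frame β] [Order.Frame γ]
    (f : FrameHom α β) (g : FrameHom α γ) : FrameHom β (FramePushout f g) :=
  (FrameCongruence.proj _).comp FrameCoprod.inl

/-- The second pushout injection. -/
noncomputable def inr {α β γ : Type u} [Order.Frame α] [Order.Frame β] [Order.Frame γ]
    (f : FrameHom α β) (g : FrameHom α γ) : FrameHom γ (FramePushout f g) :=
  (FrameCongruence.proj _).comp FrameCoprod.inr

theorem condition {α β γ : Type u} [Order.Frame α] [Order.Frame β] [Order.Frame γ]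
    (f : FrameHom α β) (g : FrameHom α γ) (a : α) : inl f g (f a) = inr f g (g a) :=
  (FrameCongruence.cls_eq _).2 fun _ hC => hC _ _ ⟨a, rfl, rfl⟩

end FramePushout

/-! ### The Booleanization of a frame -/

namespace Booleanization

/-- The regular elements `a = a**` of a frame form a complete lattice; the join of a family is the
double pseudocomplement of its join in the frame. -/
noncomputable instance instCompleteLattice {α : Type u} [Order.Frame α] :
    CompleteLattice (Heyting.Regular α) :=
  { Heyting.Regular.lattice, Heyting.Regular.boundedOrder,
    @completeLatticeOfSup (Heyting.Regular α) Heyting.Regular.instPartialOrder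
      ⟨fun s => Heyting.Regular.toRegular (sSup (Heyting.Regular.val '' s))⟩
      (fun _ => ⟨fun a ha => Heyting.Regular.coe_le_coe.1
          ((le_sSup (Set.mem_image_of_mem _ ha)).trans le_compl_compl),
        fun b hb => (Heyting.Regular.gi.gc _ b).2 (sSup_le (by
          rintro _ ⟨a, ha, rfl⟩
          exact Heyting.Regular.coe_le_coe.2 (hb ha)))⟩) with }

noncomputable instance instFrame {α : Type u} [Order.Frame α] :
    Order.Frame (Heyting.Regular α) :=
  { instCompleteLattice, (inferInstance : BooleanAlgebra (Heyting.Regular α)) with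
    himp_bot := fun a => himp_bot (α := Heyting.Regular α) a
    le_himp_iff := fun _ _ _ => le_himp_iff (α := Heyting.Regular α) }

/-- The Booleanization map `β : α → 𝔅(α)`, `a ↦ a**`. -/
noncomputable def hom (α : Type u) [Order.Frame α] : FrameHom α (Heyting.Regular α) where
  toFun := Heyting.Regular.toRegular
  map_inf' a b := Heyting.Regular.coe_injective (compl_compl_inf_distrib a b)
  map_top' := Heyting.Regular.coe_injective (by
    rw [Heyting.Regular.coe_toRegular, compl_top, compl_bot]; rfl)
  map_sSup' s := by
    rw [sSup_image]
    exact Heyting.Regular.gi.gc.l_sSup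

end Booleanization

/-! ### Biframes -/

/-- A biframe: a frame (the ambient frame) with two subframes (the component frames) that
together generate it, i.e. the only subframe containing both is the whole ambient frame. -/
structure Biframe where
  carrier : Type u
  [frame : Order.Frame carrier]
  fst : Subframe carrier
  snd : Subframe carrier
  generated : ∀ S : Subframe carrier, (∀ a ∈ fst, a ∈ S) → (∀ a ∈ snd, a ∈ S) → ∀ a, a ∈ S

attribute [instance] Biframe.frame

namespace Biframe

/-- A biframe homomorphism: a homomorphism of the ambient frames that maps each component into the
corresponding component. -/
@[ext]
structure Hom (L M : Biframe.{u}) where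
  toFrameHom : FrameHom L.carrier M.carrier
  map_fst : ∀ a ∈ L.fst, toFrameHom a ∈ M.fst
  map_snd : ∀ a ∈ L.snd, toFrameHom a ∈ M.snd

instance instCategory : Category Biframe.{u} where
  Hom := Hom
  id L := ⟨FrameHom.id L.carrier, fun _ h => h, fun _ h => h⟩
  comp f g := ⟨g.toFrameHom.comp f.toFrameHom,
    fun a h => g.map_fst _ (f.map_fst a h), fun a h => g.map_snd _ (f.map_snd a h)⟩

/-- The ambient frame of a biframe. -/
abbrev ambient (L : Biframe.{u}) : Frm.{u} := Frm.of L.carrier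

/-- The underlying morphism of ambient frames of a biframe morphism. -/
abbrev ambientMap {L M : Biframe.{u}} (f : L ⟶ M) : L.ambient ⟶ M.ambient :=
  Frm.ofHom (Hom.toFrameHom f)

/-- A biframe morphism is dense if its ambient frame homomorphism is: `f a = 0` implies `a = 0`. -/
def IsDense {L M : Biframe.{u}} (f : L ⟶ M) : Prop :=
  ∀ a : L.carrier, Hom.toFrameHom f a = ⊥ → a = ⊥

/-- The canonical homomorphism `q_L : L₁ ⊕ L₂ → L₀`. -/
noncomputable def q (L : Biframe.{u}) : FrameHom (FrameCoprod L.fst L.snd) L.carrier :=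
  FrameCoprod.desc L.fst.incl L.snd.incl

/-- The homomorphism `f₁ ⊕ f₂ : L₁ ⊕ L₂ → f[L₁] ⊕ f[L₂]` for a frame homomorphism `f` on `L₀`. -/
noncomputable def restrictCoprod (L : Biframe.{u}) {S : Type u} [Order.Frame S]
    (f : FrameHom L.carrier S) :
    FrameHom (FrameCoprod L.fst L.snd) (FrameCoprod (L.fst.map f) (L.snd.map f)) :=
  FrameCoprod.map (L.fst.mapHom f) (L.snd.mapHom f)

theorem bar_fst (L : Biframe.{u}) {S : Type u} [Order.Frame S] (f : FrameHom L.carrier S)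
    (a : L.carrier) (ha : a ∈ L.fst) :
    FramePushout.inl L.q (L.restrictCoprod f) a =
      FramePushout.inr L.q (L.restrictCoprod f)
        (FrameCoprod.inl (L.fst.mapHom f ⟨a, ha⟩)) := by
  have h := FramePushout.condition L.q (L.restrictCoprod f) (FrameCoprod.inl ⟨a, ha⟩)
  rw [q, FrameCoprod.desc_inl] at h
  refine h.trans (congrArg _ ?_)
  exact FrameCoprod.desc_inl _ _ _

theorem bar_snd (L : Biframe.{u}) {S : Type u} [Order.Frame S] (f : FrameHom L.carrier S)
    (a : L.carrier) (ha : a ∈ L.snd) :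
    FramePushout.inl L.q (L.restrictCoprod f) a =
      FramePushout.inr L.q (L.restrictCoprod f)
        (FrameCoprod.inr (L.snd.mapHom f ⟨a, ha⟩)) := by
  have h := FramePushout.condition L.q (L.restrictCoprod f) (FrameCoprod.inr ⟨a, ha⟩)
  rw [q, FrameCoprod.desc_inr] at h
  refine h.trans (congrArg _ ?_)
  exact FrameCoprod.desc_inr _ _ _

/-- The biframe `(f(L), f[L₁], f[L₂])` induced by a frame homomorphism `f : L₀ → S`. Its ambient
frame is the pushout of `f₁ ⊕ f₂` along `q_L`; each component is `f[Lᵢ]`, identified with its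
image in this pushout. -/
noncomputable def barObj (L : Biframe.{u}) {S : Type u} [Order.Frame S]
    (f : FrameHom L.carrier S) : Biframe.{u} where
  carrier := FramePushout L.q (L.restrictCoprod f)
  fst := Subframe.range ((FramePushout.inr L.q (L.restrictCoprod f)).comp FrameCoprod.inl)
  snd := Subframe.range ((FramePushout.inr L.q (L.restrictCoprod f)).comp FrameCoprod.inr)
  generated := by
    intro T h1 h2 x
    obtain ⟨y, rfl⟩ := FrameCongruence.cls_surjective _ x
    refine FrameCoprod.generated (T.comap (FrameCongruence.proj _)) ?_ ?_ y
    · intro a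
      refine L.generated (T.comap (FramePushout.inl L.q (L.restrictCoprod f))) ?_ ?_ a
      · intro b hb
        change FramePushout.inl L.q (L.restrictCoprod f) b ∈ T
        rw [L.bar_fst f b hb]
        exact h1 _ ⟨_, rfl⟩
      · intro b hb
        change FramePushout.inl L.q (L.restrictCoprod f) b ∈ T
        rw [L.bar_snd f b hb]
        exact h2 _ ⟨_, rfl⟩
    · intro b
      exact FrameCoprod.generated (T.comap (FramePushout.inr L.q (L.restrictCoprod f)))
        (fun c => h1 _ ⟨c, rfl⟩) (fun c => h2 _ ⟨c, rfl⟩) b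

/-- The biframe morphism `f̄ : L ⟶ (f(L), f[L₁], f[L₂])` induced by a frame homomorphism
`f : L₀ → S`: the pushout of `f₁ ⊕ f₂` along `q_L`. -/
noncomputable def bar (L : Biframe.{u}) {S : Type u} [Order.Frame S]
    (f : FrameHom L.carrier S) : L ⟶ L.barObj f :=
  Hom.mk (M := L.barObj f) (FramePushout.inl L.q (L.restrictCoprod f))
    (fun a ha => ⟨_, (L.bar_fst f a ha).symm⟩) (fun a ha => ⟨_, (L.bar_snd f a ha).symm⟩)

end Biframe

/-! ### Classes of extremal epimorphisms: sublocales and subbilocales -/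

/-- An extremal epimorphism with domain `X`. -/
structure ExtremalQuotient {C : Type v} [Category.{w} C] (X : C) where
  cod : C
  hom : X ⟶ cod
  extremal : ExtremalEpi hom

/-- `f ≲ g` if `f` factors through `g`. -/
instance ExtremalQuotient.instPreorder {C : Type v} [Category.{w} C] (X : C) :
    Preorder (ExtremalQuotient X) where
  le f g := ∃ h : g.cod ⟶ f.cod, g.hom ≫ h = f.hom
  le_refl f := ⟨𝟙 f.cod, Category.comp_id f.hom⟩
  le_trans _ _ _ := fun ⟨a, ha⟩ ⟨b, hb⟩ => ⟨b ≫ a, by rw [← Category.assoc, hb, ha]⟩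

/-- The poset `𝒮(X)` of equivalence classes of extremal epimorphisms with domain `X`: the
sublocales of a frame, the subbilocales of a biframe. -/
abbrev ExtremalSub {C : Type v} [Category.{w} C] (X : C) : Type (max v w) :=
  Antisymmetrization (ExtremalQuotient X) (· ≤ ·)

/-- The class `⟨f⟩` of an extremal epimorphism. -/
def ExtremalSub.mk {C : Type v} [Category.{w} C] {X Y : C} (f : X ⟶ Y) (hf : ExtremalEpi f) :
    ExtremalSub X :=
  toAntisymmetrization (· ≤ ·) (ExtremalQuotient.mk Y f hf)

namespace Biframe

/-- A sublocale of the ambient frame, resp. a subbilocale, of a biframe. -/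
abbrev Subbilocale (L : Biframe.{u}) : Type (u + 1) := ExtremalSub L

theorem isDense_of_le {L : Biframe.{u}} {f g : ExtremalQuotient L} (h : f ≤ g)
    (hf : IsDense f.hom) : IsDense g.hom := by
  obtain ⟨k, hk⟩ := h
  intro a ha
  refine hf a ?_
  rw [← hk]
  change Hom.toFrameHom k (Hom.toFrameHom g.hom a) = ⊥
  rw [ha, map_bot]

/-- A subbilocale is dense if the biframe morphisms representing it are dense. -/
def Subbilocale.IsDense {L : Biframe.{u}} (s : L.Subbilocale) : Prop :=
  Quotient.lift (fun f : ExtremalQuotient L => Biframe.IsDense f.hom)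
    (fun f g (h : AntisymmRel (· ≤ ·) f g) =>
      propext ⟨isDense_of_le h.1, isDense_of_le h.2⟩) s

end Biframe

/-! Everything rests on one description of `L.bar f`: it is the universal homomorphism on `L₀` that
identifies `a` and `b` whenever they lie in the same component and `f a = f b`. It makes these
identifications (`bar_eq_of_fst`, `bar_eq_of_snd`), and any `k` that makes them factors through it
(`exists_bar_factor`). Comparing such quotients therefore amounts to comparing identifications
inside the two components. Inflation, monotonicity and idempotence of `f ↦ f̄` follow at once.

Since the components generate, the monomorphisms of biframes are exactly the morphisms injective on
each component. Hence `L.bar f` is an extremal epimorphism, and every extremal epimorphism `g` of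
biframes is, up to isomorphism, the pushout `L.bar g` of its own ambient map (`exists_comp_eq_bar`).

Density then reduces to the classical argument. Booleanization is dense and factors through its own
bar, so that bar is dense. If `g` is dense, then `g a = g b` forces `a** = b**`, so the bar of the
Booleanization factors through `L.bar g`, which is `g`. -/

/-! ### Factorization of frame homomorphisms -/

namespace Subframe

/-- The whole frame as a subframe. -/
def univ (α : Type u) [Order.Frame α] : Subframe α where
  carrier := Set.univ
  top_mem := trivial
  inf_mem _ _ := trivial
  sSup_mem _ := trivial

/-- The least subframe. -/
def least (α : Type u) [Order.Frame α] : Subframe α where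
  carrier := {a | ∀ S : Subframe α, a ∈ S}
  top_mem S := S.top_mem
  inf_mem ha hb S := S.inf_mem (ha S) (hb S)
  sSup_mem hs S := S.sSup_mem fun _ ha => hs ha S

/-- The pairs of elements of `S` that are identified by `f`. -/
def kerPair {α : Type u} {β : Type v} [Order.Frame α] [Order.Frame β] (f : FrameHom α β)
    (S : Subframe α) : Subframe (α × α) where
  carrier := {p | p.1 ∈ S ∧ p.2 ∈ S ∧ f p.1 = f p.2}
  top_mem := ⟨S.top_mem, S.top_mem, rfl⟩
  inf_mem ha hb := ⟨S.inf_mem ha.1 hb.1, S.inf_mem ha.2.1 hb.2.1, by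
    rw [Prod.fst_inf, Prod.snd_inf, map_inf, map_inf, ha.2.2, hb.2.2]⟩
  sSup_mem {s} hs := by
    refine ⟨S.sSup_mem ?_, S.sSup_mem ?_, ?_⟩
    · rintro _ ⟨p, hp, rfl⟩
      exact (hs hp).1
    · rintro _ ⟨p, hp, rfl⟩
      exact (hs hp).2.1
    · change f (sSup (Prod.fst '' s)) = f (sSup (Prod.snd '' s))
      rw [map_sSup, map_sSup, Set.image_image, Set.image_image]
      exact congrArg sSup (Set.image_congr fun p hp => (hs hp).2.2)

/-- The first projection of a kernel pair. -/
def kerPairFst {α : Type u} {β : Type v} [Order.Frame α] [Order.Frame β] (f : FrameHom α β)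
    (S : Subframe α) : FrameHom (S.kerPair f) α where
  toFun p := p.1.1
  map_inf' _ _ := rfl
  map_top' := rfl
  map_sSup' s := by
    change sSup (Prod.fst '' (Subtype.val '' s)) = _
    rw [Set.image_image]

/-- The second projection of a kernel pair. -/
def kerPairSnd {α : Type u} {β : Type v} [Order.Frame α] [Order.Frame β] (f : FrameHom α β)
    (S : Subframe α) : FrameHom (S.kerPair f) α where
  toFun p := p.1.2
  map_inf' _ _ := rfl
  map_top' := rfl
  map_sSup' s := by
    change sSup (Prod.snd '' (Subtype.val '' s)) = _
    rw [Set.image_image]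

end Subframe

/-- A frame homomorphism whose kernel contains that of a surjection `g` factors through `g`. -/
theorem FrameHom.exists_factor {α β γ : Type*} [Order.Frame α] [Order.Frame β] [Order.Frame γ]
    (g : FrameHom α β) (hg : Function.Surjective g) (k : FrameHom α γ)
    (h : ∀ a b, g a = g b → k a = k b) : ∃ l : FrameHom β γ, ∀ a, l (g a) = k a := by
  choose s hs using hg
  -- The section `s` need not preserve anything. Each law for `k ∘ s` holds because the two
  -- arguments of `k` become equal under `g`.
  have key : ∀ a, k (s (g a)) = k a := fun a => h _ _ (hs (g a))
  refine ⟨{ toFun := fun y => k (s y), map_inf' := fun x y => ?_, map_top' := ?_,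
            map_sSup' := fun t => ?_ }, key⟩
  · rw [← map_inf]
    exact h _ _ (by rw [hs, map_inf, hs, hs])
  · exact (h _ ⊤ (by rw [hs, map_top])).trans (map_top k)
  · change k (s (sSup t)) = sSup ((fun y => k (s y)) '' t)
    rw [← Set.image_image k s t, ← map_sSup]
    refine h _ _ ?_
    rw [hs, map_sSup, Set.image_image]
    simp only [hs, Set.image_id']

/-- The universal property of the pushout. -/
theorem FramePushout.exists_desc {α β γ : Type u} {δ : Type v} [Order.Frame α] [Order.Frame β]
    [Order.Frame γ] [Order.Frame δ] (f : FrameHom α β) (g : FrameHom α γ) (k : FrameHom β δ)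
    (l : FrameHom γ δ) (h : ∀ a, k (f a) = l (g a)) :
    ∃ m : FrameHom (FramePushout f g) δ, ∀ b, m (inl f g b) = k b := by
  refine ⟨FrameCongruence.lift _ (FrameCoprod.desc k l) fun _ _ hr =>
    hr (FrameCongruence.ker (FrameCoprod.desc k l)) ?_, fun b => FrameCoprod.desc_inl k l b⟩
  rintro _ _ ⟨a, rfl, rfl⟩
  change FrameCoprod.desc k l _ = FrameCoprod.desc k l _
  rw [FrameCoprod.desc_inl, FrameCoprod.desc_inr, h]

/-- Homomorphisms out of a coproduct are determined by their components. -/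
theorem FrameCoprod.hom_apply_eq {α β : Type u} {γ : Type v} [Order.Frame α] [Order.Frame β]
    [Order.Frame γ] {f g : FrameHom (FrameCoprod α β) γ} (hl : ∀ a, f (inl a) = g (inl a))
    (hr : ∀ b, f (inr b) = g (inr b)) (x : FrameCoprod α β) : f x = g x :=
  generated
    { carrier := {x | f x = g x}
      top_mem := (map_top f).trans (map_top g).symm
      inf_mem := fun {a b} (ha : f a = g a) (hb : f b = g b) => by
        change f _ = g _
        rw [map_inf, map_inf, ha, hb]
      sSup_mem := fun {s} hs => by
        change f _ = g _
        rw [map_sSup, map_sSup]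
        exact congrArg sSup (Set.image_congr fun a ha => hs ha) } hl hr x

/-! ### Extremal epimorphisms of frames -/

namespace Frm

/-- The projections of the kernel pair of `i` agree after `i`, hence coincide; evaluating them at
`(a, b)` gives the claim. -/
theorem injective_of_mono {X Y : Frm.{u}} (i : X ⟶ Y) [Mono i] : Function.Injective i.hom := by
  intro a b hab
  have h : ofHom ((Subframe.univ X).kerPairFst i.hom) =
      ofHom ((Subframe.univ X).kerPairSnd i.hom) := by
    rw [← cancel_mono i]
    ext p
    exact p.2.2.2
  exact congrArg (fun k => k.hom ⟨(a, b), trivial, trivial, hab⟩) h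

theorem isIso_of_bijective {X Y : Frm.{u}} (i : X ⟶ Y) (hi : Function.Bijective i.hom) :
    IsIso i := by
  -- The inverse arises by factoring the identity through `i`.
  obtain ⟨l, hl⟩ := FrameHom.exists_factor i.hom hi.2 (FrameHom.id X) fun _ _ h => hi.1 h
  refine ⟨⟨ofHom l, ?_, ?_⟩⟩
  · ext x
    exact hl x
  · ext y
    obtain ⟨x, rfl⟩ := hi.2 y
    exact congrArg i.hom (hl x)

/-- A monomorphism through which a surjection factors is itself surjective, and it is injective by
`injective_of_mono`. The converse is not needed, because the bar construction works for an arbitrary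
frame homomorphism. -/
theorem extremalEpi_of_surjective {X Y : Frm.{u}} (f : X ⟶ Y) (hf : Function.Surjective f.hom) :
    ExtremalEpi f where
  left_cancellation g h e := by
    ext y
    obtain ⟨x, rfl⟩ := hf y
    exact congrArg (fun k => k.hom x) e
  isIso p i fac _ := by
    refine isIso_of_bijective i ⟨injective_of_mono i, fun y => ?_⟩
    obtain ⟨x, rfl⟩ := hf y
    exact ⟨p.hom x, congrArg (fun k => k.hom x) fac⟩

end Frm

/-! ### Biframe morphisms -/

namespace Biframe

theorem hom_ext {L M : Biframe.{u}} {f g : L ⟶ M}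
    (h : ∀ a, Hom.toFrameHom f a = Hom.toFrameHom g a) : f = g :=
  Hom.ext (DFunLike.ext _ _ h)

/-- The equalizer of the two competing morphisms is a subframe of `K` that contains both components,
so it is everything. -/
theorem mono_of_injOn {L M : Biframe.{u}} (i : L ⟶ M)
    (h₁ : ∀ a ∈ L.fst, ∀ b ∈ L.fst, Hom.toFrameHom i a = Hom.toFrameHom i b → a = b)
    (h₂ : ∀ a ∈ L.snd, ∀ b ∈ L.snd, Hom.toFrameHom i a = Hom.toFrameHom i b → a = b) :
    Mono i where
  right_cancellation {K} g h e := by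
    have e' (a : K.carrier) : Hom.toFrameHom i (Hom.toFrameHom g a) =
        Hom.toFrameHom i (Hom.toFrameHom h a) :=
      congrArg (fun k => Hom.toFrameHom k a) e
    refine hom_ext (K.generated
      { carrier := {a | Hom.toFrameHom g a = Hom.toFrameHom h a}
        top_mem := (map_top (Hom.toFrameHom g)).trans (map_top (Hom.toFrameHom h)).symm
        inf_mem := ?_
        sSup_mem := ?_ } ?_ ?_)
    · intro a b (ha : _ = _) (hb : _ = _)
      change Hom.toFrameHom g _ = Hom.toFrameHom h _
      rw [map_inf, map_inf, ha, hb]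
    · intro s hs
      change Hom.toFrameHom g _ = Hom.toFrameHom h _
      rw [map_sSup, map_sSup]
      exact congrArg sSup (Set.image_congr fun a ha => hs ha)
    · exact fun a ha => h₁ _ (g.map_fst a ha) _ (h.map_fst a ha) (e' a)
    · exact fun a ha => h₂ _ (g.map_snd a ha) _ (h.map_snd a ha) (e' a)

/-- The test object is the kernel pair of `i` restricted to `L.fst`, made into a biframe with itself
as first component and the least subframe as second. The least subframe lies in every preimage of
`L.snd`, so both projections are biframe morphisms; they agree after `i` and hence coincide. -/
theorem injOn_fst_of_mono {L M : Biframe.{u}} (i : L ⟶ M) [Mono i] (a : L.carrier)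
    (ha : a ∈ L.fst) (b : L.carrier) (hb : b ∈ L.fst)
    (hab : Hom.toFrameHom i a = Hom.toFrameHom i b) : a = b := by
  let K : Biframe.{u} :=
    { carrier := L.fst.kerPair (Hom.toFrameHom i)
      fst := Subframe.univ _
      snd := Subframe.least _
      generated := fun S h _ a => h a trivial }
  let p : K ⟶ L := Hom.mk (L := K) (L.fst.kerPairFst (Hom.toFrameHom i)) (fun x _ => x.2.1)
    (fun x hx => hx (L.snd.comap (L.fst.kerPairFst (Hom.toFrameHom i))))
  let r : K ⟶ L := Hom.mk (L := K) (L.fst.kerPairSnd (Hom.toFrameHom i)) (fun x _ => x.2.2.1)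
    (fun x hx => hx (L.snd.comap (L.fst.kerPairSnd (Hom.toFrameHom i))))
  have h : p = r := by
    rw [← cancel_mono i]
    exact hom_ext fun x => x.2.2.2
  exact congrArg (fun k : K ⟶ L => Hom.toFrameHom k ⟨(a, b), ha, hb, hab⟩) h

theorem injOn_snd_of_mono {L M : Biframe.{u}} (i : L ⟶ M) [Mono i] (a : L.carrier)
    (ha : a ∈ L.snd) (b : L.carrier) (hb : b ∈ L.snd)
    (hab : Hom.toFrameHom i a = Hom.toFrameHom i b) : a = b := by
  let K : Biframe.{u} :=
    { carrier := L.snd.kerPair (Hom.toFrameHom i)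
      fst := Subframe.least _
      snd := Subframe.univ _
      generated := fun S _ h a => h a trivial }
  let p : K ⟶ L := Hom.mk (L := K) (L.snd.kerPairFst (Hom.toFrameHom i))
    (fun x hx => hx (L.fst.comap (L.snd.kerPairFst (Hom.toFrameHom i)))) (fun x _ => x.2.1)
  let r : K ⟶ L := Hom.mk (L := K) (L.snd.kerPairSnd (Hom.toFrameHom i))
    (fun x hx => hx (L.fst.comap (L.snd.kerPairSnd (Hom.toFrameHom i)))) (fun x _ => x.2.2.1)
  have h : p = r := by
    rw [← cancel_mono i]
    exact hom_ext fun x => x.2.2.2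
  exact congrArg (fun k : K ⟶ L => Hom.toFrameHom k ⟨(a, b), ha, hb, hab⟩) h

/-! ### The morphism `L.bar f` -/

section Bar

variable (L : Biframe.{u}) {S : Type u} [Order.Frame S] (f : FrameHom L.carrier S)

/-- By commutativity of the pushout square, `L.bar f` restricted to a component factors through the
restriction of `f`. -/
theorem bar_eq_of_fst {a b : L.carrier} (ha : a ∈ L.fst) (hb : b ∈ L.fst) (h : f a = f b) :
    Hom.toFrameHom (L.bar f) a = Hom.toFrameHom (L.bar f) b := by
  refine (L.bar_fst f a ha).trans (Eq.trans ?_ (L.bar_fst f b hb).symm)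
  have e : L.fst.mapHom f ⟨a, ha⟩ = L.fst.mapHom f ⟨b, hb⟩ := Subtype.ext h
  rw [e]

theorem bar_eq_of_snd {a b : L.carrier} (ha : a ∈ L.snd) (hb : b ∈ L.snd) (h : f a = f b) :
    Hom.toFrameHom (L.bar f) a = Hom.toFrameHom (L.bar f) b := by
  refine (L.bar_snd f a ha).trans (Eq.trans ?_ (L.bar_snd f b hb).symm)
  have e : L.snd.mapHom f ⟨a, ha⟩ = L.snd.mapHom f ⟨b, hb⟩ := Subtype.ext h
  rw [e]

/-- Each component of the pushout is the image of the same component of `L`. This gives surjectivity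
of `L.bar f` and lets component conditions on `L.barObj f` be checked in `L`. -/
theorem exists_bar_eq_of_fst {x : (L.barObj f).carrier} (hx : x ∈ (L.barObj f).fst) :
    ∃ a ∈ L.fst, Hom.toFrameHom (L.bar f) a = x := by
  obtain ⟨⟨_, a, ha, rfl⟩, rfl⟩ := hx
  exact ⟨a, ha, L.bar_fst f a ha⟩

theorem exists_bar_eq_of_snd {x : (L.barObj f).carrier} (hx : x ∈ (L.barObj f).snd) :
    ∃ a ∈ L.snd, Hom.toFrameHom (L.bar f) a = x := by
  obtain ⟨⟨_, a, ha, rfl⟩, rfl⟩ := hx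
  exact ⟨a, ha, L.bar_snd f a ha⟩

theorem bar_surjective : Function.Surjective (Hom.toFrameHom (L.bar f)) :=
  (L.barObj f).generated (Subframe.range (Hom.toFrameHom (L.bar f)))
    (fun _ hx => (L.exists_bar_eq_of_fst f hx).imp fun _ h => h.2)
    (fun _ hx => (L.exists_bar_eq_of_snd f hx).imp fun _ h => h.2)

/-- A frame homomorphism `k` factors through `L.bar f` if `f a = f b` implies `k a = k b` for
elements `a`, `b` of the same component. -/
theorem exists_bar_factor {W : Type v} [Order.Frame W] (k : FrameHom L.carrier W)
    (h₁ : ∀ a ∈ L.fst, ∀ b ∈ L.fst, f a = f b → k a = k b)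
    (h₂ : ∀ a ∈ L.snd, ∀ b ∈ L.snd, f a = f b → k a = k b) :
    ∃ l : FrameHom (L.barObj f).carrier W, ∀ a, l (Hom.toFrameHom (L.bar f) a) = k a := by
  have surj (T : Subframe L.carrier) : Function.Surjective (T.mapHom f) := by
    rintro ⟨_, a, ha, rfl⟩
    exact ⟨⟨a, ha⟩, rfl⟩
  -- By `h₁` and `h₂`, the restrictions of `k` descend to `f[L₁]` and `f[L₂]`. Together they form a
  -- cocone with `k`; its commutativity is checked on the two coproduct injections.
  obtain ⟨k₁, hk₁⟩ := FrameHom.exists_factor (L.fst.mapHom f) (surj _) (k.comp L.fst.incl)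
    fun a b h => h₁ a a.2 b b.2 (congrArg Subtype.val h)
  obtain ⟨k₂, hk₂⟩ := FrameHom.exists_factor (L.snd.mapHom f) (surj _) (k.comp L.snd.incl)
    fun a b h => h₂ a a.2 b b.2 (congrArg Subtype.val h)
  refine FramePushout.exists_desc L.q (L.restrictCoprod f) k (FrameCoprod.desc k₁ k₂)
    (FrameCoprod.hom_apply_eq (f := k.comp L.q)
      (g := (FrameCoprod.desc k₁ k₂).comp (L.restrictCoprod f)) (fun a => ?_) (fun b => ?_))
  · rw [FrameHom.comp_apply, FrameHom.comp_apply, q, restrictCoprod, FrameCoprod.map,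
      FrameCoprod.desc_inl, FrameCoprod.desc_inl, FrameHom.comp_apply, FrameCoprod.desc_inl]
    exact (hk₁ a).symm
  · rw [FrameHom.comp_apply, FrameHom.comp_apply, q, restrictCoprod, FrameCoprod.map,
      FrameCoprod.desc_inr, FrameCoprod.desc_inr, FrameHom.comp_apply, FrameCoprod.desc_inr]
    exact (hk₂ b).symm

/-- A biframe morphism `k` factors through `L.bar f` if `f a = f b` implies `k a = k b` for
elements `a`, `b` of the same component. -/
theorem exists_bar_comp_eq {M : Biframe.{u}} (k : L ⟶ M)
    (h₁ : ∀ a ∈ L.fst, ∀ b ∈ L.fst, f a = f b → Hom.toFrameHom k a = Hom.toFrameHom k b)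
    (h₂ : ∀ a ∈ L.snd, ∀ b ∈ L.snd, f a = f b → Hom.toFrameHom k a = Hom.toFrameHom k b) :
    ∃ l : L.barObj f ⟶ M, L.bar f ≫ l = k := by
  obtain ⟨l, hl⟩ := L.exists_bar_factor f (Hom.toFrameHom k) h₁ h₂
  refine ⟨Hom.mk l ?_ ?_, hom_ext hl⟩
  · intro x hx
    obtain ⟨a, ha, rfl⟩ := L.exists_bar_eq_of_fst f hx
    rw [hl]
    exact k.map_fst a ha
  · intro x hx
    obtain ⟨a, ha, rfl⟩ := L.exists_bar_eq_of_snd f hx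
    rw [hl]
    exact k.map_snd a ha

instance epi_bar : Epi (L.bar f) where
  left_cancellation g h e := hom_ext fun x => by
    obtain ⟨a, rfl⟩ := L.bar_surjective f x
    exact congrArg (fun k => Hom.toFrameHom k a) e

/-- If `L.bar f` is `p` followed by a mono `i`, then `i` is injective on components, so `p` already
makes the identifications that define `L.bar f`. Thus `p` factors through `L.bar f` by some `j`,
which is inverse to `i`. -/
theorem extremalEpi_bar : ExtremalEpi (L.bar f) where
  isIso {Z} p i fac _ := by
    have hp (a : L.carrier) :
        Hom.toFrameHom i (Hom.toFrameHom p a) = Hom.toFrameHom (L.bar f) a :=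
      congrArg (fun k => Hom.toFrameHom k a) fac
    obtain ⟨j, hj⟩ := L.exists_bar_comp_eq f p
      (fun a ha b hb h => injOn_fst_of_mono i _ (p.map_fst a ha) _ (p.map_fst b hb) (by
        rw [hp, hp, L.bar_eq_of_fst f ha hb h]))
      (fun a ha b hb h => injOn_snd_of_mono i _ (p.map_snd a ha) _ (p.map_snd b hb) (by
        rw [hp, hp, L.bar_eq_of_snd f ha hb h]))
    have hji : j ≫ i = 𝟙 _ := by
      rw [← cancel_epi (L.bar f), ← Category.assoc, hj, fac, Category.comp_id]
    refine ⟨⟨j, ?_, hji⟩⟩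
    rw [← cancel_mono i, Category.assoc, hji, Category.comp_id, Category.id_comp]

theorem extremalEpi_ambientMap_bar : ExtremalEpi (ambientMap (L.bar f)) :=
  Frm.extremalEpi_of_surjective _ (L.bar_surjective f)

end Bar

/-- An extremal epimorphism of biframes is the pushout determined by its ambient map. -/
theorem exists_comp_eq_bar {L M : Biframe.{u}} (g : L ⟶ M) (hg : ExtremalEpi g) :
    ∃ l : M ⟶ L.barObj (Hom.toFrameHom g), g ≫ l = L.bar (Hom.toFrameHom g) := by
  obtain ⟨j, hj⟩ := L.exists_bar_comp_eq (Hom.toFrameHom g) g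
    (fun _ _ _ _ h => h) (fun _ _ _ _ h => h)
  have hj' (a : L.carrier) : Hom.toFrameHom j (Hom.toFrameHom (L.bar (Hom.toFrameHom g)) a) =
      Hom.toFrameHom g a := congrArg (fun k => Hom.toFrameHom k a) hj
  -- `j` is injective on components because `L.bar g` already identifies same-component pairs
  -- identified by `g`. Extremality of `g` then makes `j` invertible.
  have : Mono j := by
    refine mono_of_injOn j ?_ ?_
    · intro x hx y hy h
      obtain ⟨a, ha, rfl⟩ := L.exists_bar_eq_of_fst _ hx
      obtain ⟨b, hb, rfl⟩ := L.exists_bar_eq_of_fst _ hy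
      exact L.bar_eq_of_fst _ ha hb (by rwa [hj', hj'] at h)
    · intro x hx y hy h
      obtain ⟨a, ha, rfl⟩ := L.exists_bar_eq_of_snd _ hx
      obtain ⟨b, hb, rfl⟩ := L.exists_bar_eq_of_snd _ hy
      exact L.bar_eq_of_snd _ ha hb (by rwa [hj', hj'] at h)
  have := ExtremalEpi.isIso g _ j hj
  exact ⟨inv j, by rw [IsIso.comp_inv_eq, hj]⟩

/-! ### The closure operator on sublocales -/

/-- The map `f ↦ f̄` on extremal epimorphisms out of the ambient frame. -/
noncomputable def barQuotient (L : Biframe.{u}) :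
    ExtremalQuotient L.ambient →o ExtremalQuotient L.ambient where
  toFun f := ⟨_, _, L.extremalEpi_ambientMap_bar f.hom.hom⟩
  monotone' f g := by
    rintro ⟨h, hh⟩
    have e (a : L.carrier) : h.hom (g.hom.hom a) = f.hom.hom a :=
      congrArg (fun k => k.hom a) hh
    -- Since `f` factors through `g`, pairs identified by `g` are identified by `f`, hence by the
    -- bar of `f` when they share a component.
    obtain ⟨l, hl⟩ := L.exists_bar_factor g.hom.hom (Hom.toFrameHom (L.bar f.hom.hom))
      (fun a ha b hb hab => L.bar_eq_of_fst _ ha hb (by rw [← e, ← e, hab]))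
      (fun a ha b hb hab => L.bar_eq_of_snd _ ha hb (by rw [← e, ← e, hab]))
    exact ⟨Frm.ofHom l, by ext a; exact hl a⟩

theorem le_barQuotient (L : Biframe.{u}) (f : ExtremalQuotient L.ambient) :
    f ≤ L.barQuotient f := by
  obtain ⟨l, hl⟩ := L.exists_bar_factor f.hom.hom f.hom.hom
    (fun _ _ _ _ h => h) (fun _ _ _ _ h => h)
  exact ⟨Frm.ofHom l, by ext a; exact hl a⟩

/-- Within a component, pairs identified by `f` are identified by its bar, hence by the bar of that
bar. -/
theorem barQuotient_barQuotient_le (L : Biframe.{u}) (f : ExtremalQuotient L.ambient) :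
    L.barQuotient (L.barQuotient f) ≤ L.barQuotient f := by
  obtain ⟨l, hl⟩ := L.exists_bar_factor f.hom.hom
    (Hom.toFrameHom (L.bar (L.barQuotient f).hom.hom))
    (fun a ha b hb h => L.bar_eq_of_fst _ ha hb (L.bar_eq_of_fst _ ha hb h))
    (fun a ha b hb h => L.bar_eq_of_snd _ ha hb (L.bar_eq_of_snd _ ha hb h))
  exact ⟨Frm.ofHom l, by ext a; exact hl a⟩

/-- The closure operator `⟨f⟩ ↦ ⟨f̄⟩` on the sublocales of the ambient frame. -/
noncomputable def barClosure (L : Biframe.{u}) : ClosureOperator (ExtremalSub L.ambient) :=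
  ClosureOperator.mk' L.barQuotient.antisymmetrization L.barQuotient.antisymmetrization.monotone
    (fun s => Quotient.inductionOn s L.le_barQuotient)
    (fun s => Quotient.inductionOn s L.barQuotient_barQuotient_le)

end Biframe

/-! ### Booleanization -/

namespace Booleanization

theorem hom_surjective (α : Type u) [Order.Frame α] : Function.Surjective (hom α) :=
  fun a => ⟨a.1, Heyting.Regular.toRegular_coe a⟩

theorem eq_bot_of_hom_eq_bot {α : Type u} [Order.Frame α] {a : α} (h : hom α a = ⊥) : a = ⊥ :=
  le_bot_iff.1 (le_compl_compl.trans (congrArg Heyting.Regular.val h).le)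

/-- A dense homomorphism identifies only elements with equal double pseudocomplements. -/
theorem hom_eq_of_dense {α : Type u} {β : Type v} [Order.Frame α] [Order.Frame β]
    (g : FrameHom α β) (hg : ∀ a, g a = ⊥ → a = ⊥) {a b : α} (h : g a = g b) :
    hom α a = hom α b := by
  -- `g` sends `x ⊓ yᶜ` to `g (y ⊓ yᶜ) = ⊥`, so density gives `x ⊓ yᶜ = ⊥`.
  have key {x y : α} (hxy : g x = g y) : yᶜ ≤ xᶜ := by
    rw [le_compl_iff_disjoint_left, disjoint_iff]
    refine hg _ ?_
    rw [map_inf, hxy, ← map_inf, inf_compl_self, map_bot]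
  refine Heyting.Regular.coe_injective ?_
  change aᶜᶜ = bᶜᶜ
  rw [le_antisymm (key h.symm) (key h)]

end Booleanization

/-! ### Isbell's density theorem -/

theorem mainTheorem1 (L : Biframe.{u}) :
    ∃ B : ClosureOperator (ExtremalSub L.ambient),
      (∀ (S : Frm.{u}) (f : L.ambient ⟶ S) (hf : ExtremalEpi f),
        ∃ (_ : ExtremalEpi (L.bar f.hom)) (h₀ : ExtremalEpi (Biframe.ambientMap (L.bar f.hom))),
          B (ExtremalSub.mk f hf) = ExtremalSub.mk (Biframe.ambientMap (L.bar f.hom)) h₀) ∧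
      ∃ (hβ : ExtremalEpi (Frm.ofHom (Booleanization.hom L.carrier)))
        (hb : ExtremalEpi (L.bar (Booleanization.hom L.carrier)))
        (hb₀ : ExtremalEpi (Biframe.ambientMap (L.bar (Booleanization.hom L.carrier)))),
        B (ExtremalSub.mk (Frm.ofHom (Booleanization.hom L.carrier)) hβ) =
            ExtremalSub.mk (Biframe.ambientMap (L.bar (Booleanization.hom L.carrier))) hb₀ ∧
          IsLeast {s : L.Subbilocale | s.IsDense}
            (ExtremalSub.mk (L.bar (Booleanization.hom L.carrier)) hb) := by
  have hβ : ExtremalEpi (Frm.ofHom (Booleanization.hom L.carrier)) :=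
    Frm.extremalEpi_of_surjective _ (Booleanization.hom_surjective _)
  refine ⟨L.barClosure, fun S f hf => ⟨L.extremalEpi_bar _, L.extremalEpi_ambientMap_bar _, rfl⟩,
    hβ, L.extremalEpi_bar _, L.extremalEpi_ambientMap_bar _, rfl, ?_, ?_⟩
  · intro a ha
    -- Booleanization factors through its own bar, so whatever the bar sends to `⊥`, Booleanization
    -- does too.
    obtain ⟨l, hl⟩ := L.exists_bar_factor _ (Booleanization.hom L.carrier)
      (fun _ _ _ _ h => h) (fun _ _ _ _ h => h)
    refine Booleanization.eq_bot_of_hom_eq_bot ?_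
    rw [← hl, ← map_bot l]
    exact congrArg l ha
  · intro s
    refine Quotient.inductionOn s fun g (hg : Biframe.IsDense g.hom) => ?_
    -- `l` passes from `g` to the bar of its ambient map; `m` passes from there to the bar of the
    -- Booleanization and exists because `g` is dense.
    obtain ⟨l, hl⟩ := Biframe.exists_comp_eq_bar g.hom g.extremal
    obtain ⟨m, hm⟩ := L.exists_bar_comp_eq (Biframe.Hom.toFrameHom g.hom)
      (L.bar (Booleanization.hom L.carrier))
      (fun a ha b hb h => L.bar_eq_of_fst _ ha hb (Booleanization.hom_eq_of_dense _ hg h))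
      (fun a ha b hb h => L.bar_eq_of_snd _ ha hb (Booleanization.hom_eq_of_dense _ hg h))
    exact ⟨l ≫ m, by rw [← Category.assoc, hl, hm]⟩
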